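/- Let $(M,d)$ be a complete metric space with a distinguished base point $0\in M$. Let $\mathrm{Lip}_0(M)$ be the Banach space of all Lipschitz functions $f\colon M\to\mathbb{R}$ with $f(0)=0$, normed by the Lipschitz constant. For $x\in M$ let $\delta(x)\in \mathrm{Lip}_0(M)^*$ be the evaluation $f\mapsto f(x)$, and let $\mathcal{F}(M)=\overline{\mathrm{span}}\,\{\delta(x):x\in M\}\subset\mathrm{Lip}_0(M)^*$ (norm closure) be the Lipschitz-free space over $M$. Order $\mathrm{Lip}_0(M)^*$, and its subspace $\mathcal{F}(M)$, by declaring $\phi\le\psi$ if $\phi(f)\le\psi(f)$ for every $f\in\mathrm{Lip}_0(M)$ with $f\ge 0$ pointwise. If $X$ is an ordered vector space and $x\in X$, a majorant of $x$ in $X$ is an element $y\in X$ with $y\ge 0$ and $x\le y$; $x$ is majorizable in $X$ if it has a majorant in $X$; a minimum majorant of $x$ in $X$ is a majorant $y$ of $x$ such that every majorant of $x$ in $X$ is also a majorant of $y$ (it is unique if it exists). A positive Borel measure on $M$ is Radon if it is finite, inner regular with respect to compact sets, and outer regular with respect to open sets; a positive Borel measure $\mu$ on $M$ is almost Radon if $\mu(\{0\})=0$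 and the restriction $\mu|_K$ is Radon for every closed $K\subset M$ with $0\notin K$. A functional $\phi\in\mathrm{Lip}_0(M)^*$ is represented by $\mu$ if every $f\in\mathrm{Lip}_0(M)$ is $\mu$-integrable and $\phi(f)=\int_M f\,d\mu$. Let $m\in\mathcal{F}(M)$. Then $m$ is majorizable in $\mathcal{F}(M)$ if and only if it is majorizable in $\mathrm{Lip}_0(M)^*$. In that case there is an element $m^+\in\mathcal{F}(M)$ which is the minimum majorant of $m$ both in $\mathcal{F}(M)$ and in $\mathrm{Lip}_0(M)^*$. Moreover, $m^+$ and $m^-=m^+-m$ are represented by positive almost Radon measures $\mu^+$ and $\mu^-$ on $M$, respectively, and there are disjoint Borel sets $A^+,A^-\subset M$ with $\mu^+(M\setminus A^+)=0$ and $\mu^-(M\setminus A^-)=0$. -/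

import Mathlib

open MeasureTheory

noncomputable section

namespace LipFree

/-! ### The space of Lipschitz functions vanishing at the base point -/

/-- The vector space of real-valued Lipschitz functions on `M` vanishing at the base point `o`,
as a subspace of `M → ℝ`. -/
def lip0Submodule {M : Type*} [MetricSpace M] (o : M) : Submodule ℝ (M → ℝ) where
  carrier := {f | f o = 0 ∧ ∃ K : ℝ, 0 ≤ K ∧ ∀ x y, |f x - f y| ≤ K * dist x y}
  zero_mem' := ⟨rfl, 0, le_rfl, fun x y => by simp⟩
  add_mem' := by
    rintro f g ⟨hf, K, hK, hfK⟩ ⟨hg, L, hL, hgL⟩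
    refine ⟨by simp [hf, hg], K + L, add_nonneg hK hL, fun x y => ?_⟩
    have e : (f + g) x - (f + g) y = (f x - f y) + (g x - g y) := by
      simp only [Pi.add_apply]; ring
    rw [e, add_mul]
    exact (abs_add_le _ _).trans (add_le_add (hfK x y) (hgL x y))
  smul_mem' := by
    rintro c f ⟨hf, K, hK, hfK⟩
    refine ⟨by simp [hf], |c| * K, mul_nonneg (abs_nonneg c) hK, fun x y => ?_⟩
    have e : (c • f) x - (c • f) y = c * (f x - f y) := by
      simp only [Pi.smul_apply, smul_eq_mul]; ring
    rw [e, abs_mul, mul_assoc]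
    exact mul_le_mul_of_nonneg_left (hfK x y) (abs_nonneg c)

/-- The space `Lip₀(M)`. It is a separate type so that it carries the Lipschitz norm only. -/
def Lip0 {M : Type*} [MetricSpace M] (o : M) : Type _ := ↥(lip0Submodule o)

section

variable {M : Type*} [MetricSpace M] {o : M}

instance : AddCommGroup (Lip0 o) := inferInstanceAs (AddCommGroup ↥(lip0Submodule o))

instance : Module ℝ (Lip0 o) := inferInstanceAs (Module ℝ ↥(lip0Submodule o))

instance : FunLike (Lip0 o) M ℝ where
  coe f := f.1
  coe_injective := Subtype.val_injective

@[simp] theorem Lip0.add_apply (f g : Lip0 o) (x : M) : (f + g) x = f x + g x := rfl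

@[simp] theorem Lip0.smul_apply (c : ℝ) (f : Lip0 o) (x : M) : (c • f) x = c * f x := rfl

@[simp] theorem Lip0.zero_apply (x : M) : (0 : Lip0 o) x = 0 := rfl

@[simp] theorem Lip0.apply_base (f : Lip0 o) : f o = 0 := f.2.1

/-- The set of Lipschitz constants of `f`. -/
def Lip0.constants (f : Lip0 o) : Set ℝ := {K | 0 ≤ K ∧ ∀ x y, |f x - f y| ≤ K * dist x y}

/-- The norm of `f` is its best Lipschitz constant. -/
instance : Norm (Lip0 o) where
  norm f := sInf f.constants

theorem Lip0.constants_nonempty (f : Lip0 o) : f.constants.Nonempty := f.2.2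

theorem Lip0.bddBelow_constants (f : Lip0 o) : BddBelow f.constants := ⟨0, fun _ h => h.1⟩

theorem Lip0.norm_le (f : Lip0 o) {K : ℝ} (hK : 0 ≤ K)
    (h : ∀ x y, |f x - f y| ≤ K * dist x y) : ‖f‖ ≤ K :=
  csInf_le f.bddBelow_constants ⟨hK, h⟩

theorem Lip0.norm_nonneg' (f : Lip0 o) : 0 ≤ ‖f‖ :=
  le_csInf f.constants_nonempty fun _ h => h.1

theorem Lip0.abs_sub_le (f : Lip0 o) (x y : M) : |f x - f y| ≤ ‖f‖ * dist x y := by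
  rcases eq_or_lt_of_le (dist_nonneg (x := x) (y := y)) with h | h
  · have hxy : x = y := dist_eq_zero.mp h.symm
    simp [hxy]
  · rw [← div_le_iff₀ h]
    exact le_csInf f.constants_nonempty fun K hK => (div_le_iff₀ h).mpr (hK.2 x y)

theorem Lip0.norm_smul_le' (c : ℝ) (f : Lip0 o) : ‖c • f‖ ≤ |c| * ‖f‖ := by
  refine Lip0.norm_le _ (mul_nonneg (abs_nonneg c) f.norm_nonneg') fun x y => ?_
  rw [Lip0.smul_apply, Lip0.smul_apply, ← mul_sub, abs_mul, mul_assoc]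
  exact mul_le_mul_of_nonneg_left (f.abs_sub_le x y) (abs_nonneg c)

theorem Lip0.normedSpaceCore : NormedSpace.Core ℝ (Lip0 o) where
  norm_nonneg := Lip0.norm_nonneg'
  norm_smul c f := by
    refine le_antisymm (Lip0.norm_smul_le' c f) ?_
    rcases eq_or_ne c 0 with rfl | hc
    · simpa using Lip0.norm_nonneg' _
    · have h := Lip0.norm_smul_le' c⁻¹ (c • f)
      rw [smul_smul, inv_mul_cancel₀ hc, one_smul, abs_inv, inv_mul_eq_div,
        le_div_iff₀ (abs_pos.mpr hc)] at h
      rwa [Real.norm_eq_abs, mul_comm]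
  norm_triangle f g := by
    refine Lip0.norm_le _ (add_nonneg f.norm_nonneg' g.norm_nonneg') fun x y => ?_
    have e : (f + g) x - (f + g) y = (f x - f y) + (g x - g y) := by
      simp only [Lip0.add_apply]; ring
    rw [e, add_mul]
    exact (abs_add_le _ _).trans (add_le_add (f.abs_sub_le x y) (g.abs_sub_le x y))
  norm_eq_zero_iff f := by
    constructor
    · intro h
      refine DFunLike.ext _ _ fun x => ?_
      have h1 := f.abs_sub_le x o
      rw [h, zero_mul, Lip0.apply_base, sub_zero] at h1
      exact abs_nonpos_iff.mp h1
    · rintro rfl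
      exact le_antisymm (Lip0.norm_le _ le_rfl fun x y => by simp) (Lip0.norm_nonneg' _)

instance : NormedAddCommGroup (Lip0 o) := NormedAddCommGroup.ofCore Lip0.normedSpaceCore

instance : NormedSpace ℝ (Lip0 o) := NormedSpace.ofCore Lip0.normedSpaceCore

/-- The pointwise order. -/
instance : PartialOrder (Lip0 o) := PartialOrder.lift (fun f => (f : M → ℝ)) DFunLike.coe_injective

theorem Lip0.nonneg_iff (f : Lip0 o) : 0 ≤ f ↔ ∀ x, 0 ≤ f x := Iff.rfl

/-- Every element of `Lip₀(M)` is a difference of two positive elements. -/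
theorem Lip0.exists_sub (f : Lip0 o) : ∃ g h : Lip0 o, 0 ≤ g ∧ 0 ≤ h ∧ f = g - h := by
  let g : Lip0 o := ⟨fun x => max (f x) 0, by simp, ‖f‖, f.norm_nonneg', fun x y =>
    (abs_max_sub_max_le_abs (f x) (f y) 0).trans (f.abs_sub_le x y)⟩
  have hg : ∀ x, g x = max (f x) 0 := fun _ => rfl
  refine ⟨g, g - f, ?_, ?_, by abel⟩
  · exact fun x => le_max_right _ _
  · intro x
    have e : (g - f) x = g x - f x := rfl
    change 0 ≤ (g - f) x
    rw [e, hg]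
    exact sub_nonneg.mpr (le_max_left _ _)

/-! ### The dual of `Lip₀(M)` and the Lipschitz-free space -/

/-- The order on `Lip₀(M)*`: `φ ≤ ψ` when `ψ - φ` takes nonnegative values on positive functions. -/
instance : PartialOrder (StrongDual ℝ (Lip0 o)) where
  le φ ψ := ∀ f : Lip0 o, 0 ≤ f → φ f ≤ ψ f
  le_refl _ _ _ := le_rfl
  le_trans _ _ _ h₁ h₂ f hf := (h₁ f hf).trans (h₂ f hf)
  le_antisymm φ ψ h₁ h₂ := by
    ext f
    obtain ⟨g, h, hg, hh, rfl⟩ := f.exists_sub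
    rw [map_sub, map_sub, le_antisymm (h₁ g hg) (h₂ g hg), le_antisymm (h₁ h hh) (h₂ h hh)]

/-- The evaluation functional `f ↦ f x`. -/
def delta (o x : M) : StrongDual ℝ (Lip0 o) :=
  LinearMap.mkContinuous
    { toFun := fun f => f x, map_add' := fun _ _ => rfl, map_smul' := fun _ _ => rfl }
    (dist x o) fun f => by
      have h := f.abs_sub_le x o
      rw [Lip0.apply_base, sub_zero, mul_comm] at h
      exact h

/-- The Lipschitz-free space over `M`: the closed linear span of the evaluation functionals
in `Lip₀(M)*`, with the order inherited from `Lip₀(M)*`. -/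
def lipFree (o : M) : Submodule ℝ (StrongDual ℝ (Lip0 o)) :=
  (Submodule.span ℝ (Set.range (delta o))).topologicalClosure

/-! ### Majorants in an ordered vector space -/

/-- `y` is a majorant of `x`. -/
def IsMajorant {X : Type*} [AddCommGroup X] [PartialOrder X] (x y : X) : Prop :=
  0 ≤ y ∧ x ≤ y

/-- `x` is majorizable (in `X`). -/
def Majorizable {X : Type*} [AddCommGroup X] [PartialOrder X] (x : X) : Prop :=
  ∃ y : X, IsMajorant x y

/-- `y` is the minimum majorant of `x`: a majorant such that every majorant of `x` is also a
majorant of `y`. -/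
def IsMinimumMajorant {X : Type*} [AddCommGroup X] [PartialOrder X] (x y : X) : Prop :=
  IsMajorant x y ∧ ∀ z : X, IsMajorant x z → IsMajorant y z

/-! ### Measures -/

/-- Radon: finite, inner regular with respect to compact sets, and outer regular. -/
def IsRadon {X : Type*} [TopologicalSpace X] [MeasurableSpace X] (μ : Measure X) : Prop :=
  IsFiniteMeasure μ ∧ μ.InnerRegular ∧ μ.OuterRegular

/-- Almost Radon positive measures on the pointed space `(M, o)`. -/
def IsAlmostRadon [MeasurableSpace M] (o : M) (μ : Measure M) : Prop :=
  μ {o} = 0 ∧ ∀ K : Set M, IsClosed K → o ∉ K → IsRadon (μ.restrict K)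

/-- The functional `φ` on `Lip₀(M)` is represented by the positive measure `μ`. -/
def IsRepresentedBy [MeasurableSpace M] (φ : StrongDual ℝ (Lip0 o)) (μ : Measure M) : Prop :=
  ∀ f : Lip0 o, Integrable (fun x => f x) μ ∧ φ f = ∫ x, f x ∂μ

end

end LipFree

end

open LipFree

noncomputable section

namespace LipFree

open Filter Topology Set
open scoped NNReal ENNReal

section

variable {M : Type*} [MetricSpace M] {o : M}

/-! ### Lattice operations on `Lip₀(M)` -/

/-! If `m` is majorizable in the dual, the Riesz–Kantorovich formula `p f = sup {m g : 0 ≤ g ≤ f}`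
gives its minimum majorant there (`exists_isLUB_intervalValues`). The whole problem is to show that
`p` lies in the Lipschitz-free space.

The property that makes this work is normality. Elements of the Lipschitz-free space are normal, and
normality passes from `m` to `p` (`IsNormal.of_isLUB`), hence also to `p - m`. A positive normal `φ`
is given by a measure (`IsNormal.exists_isAlmostRadon`). With `w = min (d(·, o)) 1`, the functional
`h ↦ φ (h w)` is positive on bounded Lipschitz functions and so comes from a measure on the
Stone–Čech compactification. Normality and completeness force that measure onto a countable union of
compact subsets of `M`, and dividing it by `w` represents `φ`.

For a measure carried by such a union, the evaluation map is Bochner integrable, so the represented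
functional is in the closed span of the evaluations. Finally, a nonzero common minorant of the two
measures could be subtracted from `p` to give a smaller majorant, so they are mutually singular. -/

@[simp] theorem Lip0.sub_apply (f g : Lip0 o) (x : M) : (f - g) x = f x - g x := rfl

theorem Lip0.le_def (f g : Lip0 o) : f ≤ g ↔ ∀ x, f x ≤ g x := Iff.rfl

/-- A Lipschitz function vanishing at the base point, as an element of `Lip₀(M)`. -/
def Lip0.ofLipschitz {K : ℝ≥0} (f : M → ℝ) (h0 : f o = 0) (hf : LipschitzWith K f) : Lip0 o :=
  ⟨f, h0, K, K.2, fun x y => by simpa [Real.dist_eq] using hf.dist_le_mul x y⟩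

@[simp] theorem Lip0.ofLipschitz_apply {K : ℝ≥0} (f : M → ℝ) (h0 : f o = 0)
    (hf : LipschitzWith K f) (x : M) : Lip0.ofLipschitz f h0 hf x = f x := rfl

theorem Lip0.norm_ofLipschitz_le {K : ℝ≥0} (f : M → ℝ) (h0 : f o = 0)
    (hf : LipschitzWith K f) : ‖Lip0.ofLipschitz f h0 hf‖ ≤ K :=
  Lip0.norm_le _ K.2 fun x y => by simpa [Real.dist_eq] using hf.dist_le_mul x y

theorem Lip0.lipschitzWith (f : Lip0 o) : LipschitzWith ‖f‖₊ f :=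
  LipschitzWith.of_dist_le_mul fun x y => by simpa [Real.dist_eq] using f.abs_sub_le x y

theorem Lip0.continuous (f : Lip0 o) : Continuous f := f.lipschitzWith.continuous

theorem Lip0.abs_apply_le (f : Lip0 o) (x : M) : |f x| ≤ ‖f‖ * dist x o := by
  simpa using f.abs_sub_le x o

/-- The distance to the base point. -/
def Lip0.rho (o : M) : Lip0 o :=
  Lip0.ofLipschitz (fun x => dist x o) (dist_self o) (LipschitzWith.dist_left o)

@[simp] theorem Lip0.rho_apply (x : M) : Lip0.rho o x = dist x o := rfl

theorem Lip0.rho_nonneg : 0 ≤ Lip0.rho o := fun _ => dist_nonneg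

/-- The pointwise minimum of two functions. -/
def Lip0.inf (f g : Lip0 o) : Lip0 o :=
  Lip0.ofLipschitz (fun x => min (f x) (g x)) (by simp) (f.lipschitzWith.min g.lipschitzWith)

@[simp] theorem Lip0.inf_apply (f g : Lip0 o) (x : M) : f.inf g x = min (f x) (g x) := rfl

theorem Lip0.norm_inf_le (f g : Lip0 o) : ‖f.inf g‖ ≤ max ‖f‖ ‖g‖ := by
  have h := Lip0.norm_ofLipschitz_le (o := o) (fun x => min (f x) (g x)) (by simp)
    (f.lipschitzWith.min g.lipschitzWith)
  rwa [NNReal.coe_max] at h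

/-- The positive part of a function. -/
def Lip0.pos (f : Lip0 o) : Lip0 o :=
  Lip0.ofLipschitz (fun x => max (f x) 0) (by simp) (f.lipschitzWith.max_const 0)

@[simp] theorem Lip0.pos_apply (f : Lip0 o) (x : M) : f.pos x = max (f x) 0 := rfl

theorem Lip0.pos_nonneg (f : Lip0 o) : 0 ≤ f.pos := fun _ => le_max_right _ _

theorem Lip0.le_pos (f : Lip0 o) : f ≤ f.pos := fun _ => le_max_left _ _

theorem Lip0.norm_pos_le (f : Lip0 o) : ‖f.pos‖ ≤ ‖f‖ :=
  Lip0.norm_ofLipschitz_le (o := o) (fun x => max (f x) 0) (by simp) (f.lipschitzWith.max_const 0)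

theorem Lip0.sub_nonneg {f g : Lip0 o} : 0 ≤ g - f ↔ f ≤ g := by
  simp [Lip0.le_def]

theorem Lip0.add_nonneg {f g : Lip0 o} (hf : 0 ≤ f) (hg : 0 ≤ g) : 0 ≤ f + g :=
  fun x => _root_.add_nonneg (hf x) (hg x)

theorem Lip0.smul_nonneg {c : ℝ} (hc : 0 ≤ c) {f : Lip0 o} (hf : 0 ≤ f) : 0 ≤ c • f :=
  fun x => mul_nonneg hc (hf x)

theorem dual_apply_mono {φ : StrongDual ℝ (Lip0 o)} (hφ : 0 ≤ φ) {f g : Lip0 o} (h : f ≤ g) :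
    φ f ≤ φ g := by
  have := hφ (g - f) (Lip0.sub_nonneg.2 h)
  rw [map_sub] at this
  simpa using this

/-! ### Extending additive functionals from the positive cone -/

/-- A positively homogeneous additive function on the positive cone of `Lip₀(M)`, dominated by
`0 ≤ p f ≤ φ f`, extends to a bounded linear functional. -/
theorem exists_dual_of_cone (p : Lip0 o → ℝ) (φ : StrongDual ℝ (Lip0 o))
    (hadd : ∀ f g, 0 ≤ f → 0 ≤ g → p (f + g) = p f + p g)
    (hsmul : ∀ (c : ℝ) f, 0 ≤ c → 0 ≤ f → p (c • f) = c * p f)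
    (h0 : ∀ f, 0 ≤ f → 0 ≤ p f) (hle : ∀ f, 0 ≤ f → p f ≤ φ f) :
    ∃ ψ : StrongDual ℝ (Lip0 o), ∀ f, 0 ≤ f → ψ f = p f := by
  -- By `key`, the value does not depend on how `f` is written as a difference of positive
  -- functions; linearity then follows by choosing convenient decompositions.
  let E : Lip0 o → ℝ := fun f => p f.pos - p (f.pos - f)
  have key : ∀ f g h : Lip0 o, 0 ≤ g → 0 ≤ h → f = g - h → E f = p g - p h := by
    intro f g h hg hh e
    have h1 := hadd f.pos h f.pos_nonneg hh
    have h2 := hadd g (f.pos - f) hg (Lip0.sub_nonneg.2 f.le_pos)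
    have h3 : f.pos + h = g + (f.pos - f) := by rw [e]; abel
    rw [h3, h2] at h1
    simp only [E]
    linarith
  have hn : ∀ f : Lip0 o, 0 ≤ f.pos - f := fun f => Lip0.sub_nonneg.2 f.le_pos
  let L : Lip0 o →ₗ[ℝ] ℝ :=
    { toFun := E
      map_add' := fun f g => by
        rw [key (f + g) (f.pos + g.pos) ((f.pos - f) + (g.pos - g))
          (Lip0.add_nonneg f.pos_nonneg g.pos_nonneg) (Lip0.add_nonneg (hn f) (hn g)) (by abel),
          hadd _ _ f.pos_nonneg g.pos_nonneg, hadd _ _ (hn f) (hn g)]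
        simp only [E]; ring
      map_smul' := fun c f => by
        rcases le_total 0 c with hc | hc
        · rw [key (c • f) (c • f.pos) (c • (f.pos - f)) (Lip0.smul_nonneg hc f.pos_nonneg)
            (Lip0.smul_nonneg hc (hn f)) (by rw [← smul_sub]; congr 1; abel),
            hsmul _ _ hc f.pos_nonneg, hsmul _ _ hc (hn f)]
          simp only [E, RingHom.id_apply, smul_eq_mul]; ring
        · have hc' : 0 ≤ -c := neg_nonneg.2 hc
          rw [key (c • f) ((-c) • (f.pos - f)) ((-c) • f.pos) (Lip0.smul_nonneg hc' (hn f))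
            (Lip0.smul_nonneg hc' f.pos_nonneg)
            (by rw [← smul_sub, neg_smul, ← smul_neg]; congr 1; abel),
            hsmul _ _ hc' f.pos_nonneg, hsmul _ _ hc' (hn f)]
          simp only [E, RingHom.id_apply, smul_eq_mul]; ring }
  -- The factor 3 is 1 for the positive part plus 2 for `f.pos - f`, whose norm is estimated by the
  -- triangle inequality.
  have hL : ∀ f : Lip0 o, ‖L f‖ ≤ (3 * ‖φ‖) * ‖f‖ := by
    intro f
    have a1 := h0 _ f.pos_nonneg
    have a2 := h0 _ (hn f)
    have b1 := (hle _ f.pos_nonneg).trans ((le_abs_self _).trans (φ.le_opNorm _))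
    have b2 := (hle _ (hn f)).trans ((le_abs_self _).trans (φ.le_opNorm _))
    have c1 := f.norm_pos_le
    have c2 : ‖f.pos - f‖ ≤ 2 * ‖f‖ := (norm_sub_le _ _).trans (by linarith)
    have d1 := mul_le_mul_of_nonneg_left c1 (norm_nonneg φ)
    have d2 := mul_le_mul_of_nonneg_left c2 (norm_nonneg φ)
    have : L f = p f.pos - p (f.pos - f) := rfl
    rw [this, Real.norm_eq_abs, abs_le]
    have e : 0 ≤ ‖φ‖ * ‖f‖ := by positivity
    constructor <;> linarith
  refine ⟨L.mkContinuous _ hL, fun f hf => ?_⟩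
  have h00 : p 0 = 0 := by simpa using hsmul 0 0 le_rfl le_rfl
  have := key f f 0 hf le_rfl (by simp)
  rw [h00, sub_zero] at this
  exact this

/-! ### The minimum majorant in the dual -/

/-- The values of `m` on the order interval `[0, f]`. -/
def intervalValues (m : StrongDual ℝ (Lip0 o)) (f : Lip0 o) : Set ℝ :=
  {r | ∃ g : Lip0 o, 0 ≤ g ∧ g ≤ f ∧ m g = r}

/-- The Riesz–Kantorovich formula for the positive part of a majorizable functional. -/
theorem exists_isLUB_intervalValues {m φ : StrongDual ℝ (Lip0 o)} (hφ : IsMajorant m φ) :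
    ∃ p : StrongDual ℝ (Lip0 o), ∀ f, 0 ≤ f → IsLUB (intervalValues m f) (p f) := by
  have hne : ∀ f : Lip0 o, 0 ≤ f → (intervalValues m f).Nonempty :=
    fun f hf => ⟨m 0, 0, le_rfl, hf, rfl⟩
  have hub : ∀ f, φ f ∈ upperBounds (intervalValues m f) := by
    rintro f _ ⟨g, hg, hgf, rfl⟩
    exact (hφ.2 g hg).trans (dual_apply_mono hφ.1 hgf)
  have hlub : ∀ f, 0 ≤ f → IsLUB (intervalValues m f) (sSup (intervalValues m f)) :=
    fun f hf => isLUB_csSup (hne f hf) ⟨_, hub f⟩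
  set p : Lip0 o → ℝ := fun f => sSup (intervalValues m f) with hp
  have hadd : ∀ f g, 0 ≤ f → 0 ≤ g → p (f + g) = p f + p g := by
    intro f g hf hg
    refine IsLUB.unique (hlub _ (Lip0.add_nonneg hf hg)) ?_
    have h := (hlub f hf).add (hlub g hg)
    convert h using 1
    ext r
    rw [Set.mem_add]
    constructor
    -- Riesz decomposition: `k` splits into `k ∧ f ≤ f` and `k - k ∧ f ≤ g`.
    · rintro ⟨k, hk, hkfg, rfl⟩
      refine ⟨_, ⟨k.inf f, fun x => le_min (hk x) (hf x), fun x => min_le_right _ _, rfl⟩, _,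
        ⟨k - k.inf f, fun x => by simp, fun x => ?_, rfl⟩, by rw [← map_add]; congr 1; abel⟩
      have h1 := hkfg x
      have h2 := hg x
      simp only [Lip0.add_apply, Lip0.zero_apply] at h1 h2
      simp only [Lip0.sub_apply, Lip0.inf_apply]
      rcases min_cases (k x) (f x) with h | h <;> rw [h.1] <;> linarith
    · rintro ⟨_, ⟨a, ha, haf, rfl⟩, _, ⟨b, hb, hbg, rfl⟩, rfl⟩
      exact ⟨a + b, Lip0.add_nonneg ha hb, fun x => add_le_add (haf x) (hbg x), map_add _ _ _⟩
  have hle : ∀ (c : ℝ) f, 0 < c → 0 ≤ f → c * p f ≤ p (c • f) := by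
    intro c f hc hf
    rw [← le_div_iff₀' hc]
    refine (isLUB_le_iff (hlub f hf)).2 ?_
    rintro _ ⟨g, hg, hgf, rfl⟩
    rw [le_div_iff₀' hc]
    exact (hlub _ (Lip0.smul_nonneg hc.le hf)).1 ⟨c • g, Lip0.smul_nonneg hc.le hg,
      fun x => mul_le_mul_of_nonneg_left (hgf x) hc.le, by simp⟩
  have hp0 : p 0 = 0 := by simpa using hadd 0 0 le_rfl le_rfl
  have hsmul : ∀ (c : ℝ) f, 0 ≤ c → 0 ≤ f → p (c • f) = c * p f := by
    intro c f hc hf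
    rcases hc.eq_or_lt with rfl | hc
    · simp [hp0]
    refine le_antisymm ?_ (hle c f hc hf)
    have := hle c⁻¹ (c • f) (inv_pos.2 hc) (Lip0.smul_nonneg hc.le hf)
    rwa [smul_smul, inv_mul_cancel₀ hc.ne', one_smul, inv_mul_le_iff₀ hc] at this
  obtain ⟨ψ, hψ⟩ := exists_dual_of_cone p φ hadd hsmul
    (fun f hf => (hlub f hf).1 ⟨0, le_rfl, hf, map_zero _⟩) (fun f hf => (hlub f hf).2 (hub f))
  exact ⟨ψ, fun f hf => by rw [hψ f hf]; exact hlub f hf⟩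

theorem isMinimumMajorant_of_isLUB {m p : StrongDual ℝ (Lip0 o)}
    (hp : ∀ f, 0 ≤ f → IsLUB (intervalValues m f) (p f)) : IsMinimumMajorant m p := by
  have h0 : 0 ≤ p := fun f hf => (hp f hf).1 ⟨0, le_rfl, hf, map_zero _⟩
  refine ⟨⟨h0, fun f hf => (hp f hf).1 ⟨f, hf, le_rfl, rfl⟩⟩, fun z hz => ⟨hz.1, fun f hf => ?_⟩⟩
  refine (hp f hf).2 ?_
  rintro _ ⟨g, hg, hgf, rfl⟩
  exact (hz.2 g hg).trans (dual_apply_mono hz.1 hgf)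

/-! ### Normal functionals -/

/-- The trace of the topology of pointwise convergence at `0` on the positive functions of norm at
most `C`. -/
def boundedNhds (o : M) (C : ℝ) : Filter (Lip0 o) :=
  comap (fun f : Lip0 o => (f : M → ℝ)) (𝓝 0) ⊓ 𝓟 {f | 0 ≤ f ∧ ‖f‖ ≤ C}

theorem tendsto_boundedNhds {ι : Type*} {l : Filter ι} {C : ℝ} {u : ι → Lip0 o}
    (h0 : ∀ i, 0 ≤ u i) (hC : ∀ i, ‖u i‖ ≤ C) (h : ∀ x, Tendsto (fun i => u i x) l (𝓝 0)) :
    Tendsto u l (boundedNhds o C) :=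
  tendsto_inf.2 ⟨tendsto_comap_iff.2 (tendsto_pi_nhds.2 h),
    tendsto_principal.2 (Eventually.of_forall fun i => ⟨h0 i, hC i⟩)⟩

theorem eventually_boundedNhds (o : M) (C : ℝ) : ∀ᶠ f in boundedNhds o C, 0 ≤ f ∧ ‖f‖ ≤ C :=
  mem_inf_of_right (mem_principal_self _)

theorem tendsto_apply_boundedNhds (C : ℝ) (x : M) :
    Tendsto (fun f : Lip0 o => f x) (boundedNhds o C) (𝓝 0) :=
  (tendsto_pi_nhds.1 (tendsto_comap (f := fun f : Lip0 o => (f : M → ℝ)) (x := 𝓝 0)) x).mono_left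
    inf_le_left

/-- A functional on `Lip₀(M)` is normal if it is continuous at `0` on bounded sets of positive
functions with respect to pointwise convergence. -/
def IsNormal (φ : StrongDual ℝ (Lip0 o)) : Prop :=
  ∀ C : ℝ, Tendsto φ (boundedNhds o C) (𝓝 0)

theorem IsNormal.tendsto {φ : StrongDual ℝ (Lip0 o)} (hφ : IsNormal φ) {ι : Type*} {l : Filter ι}
    {C : ℝ} {u : ι → Lip0 o} (h0 : ∀ i, 0 ≤ u i) (hC : ∀ i, ‖u i‖ ≤ C)
    (h : ∀ x, Tendsto (fun i => u i x) l (𝓝 0)) : Tendsto (fun i => φ (u i)) l (𝓝 0) :=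
  (hφ C).comp (tendsto_boundedNhds h0 hC h)

theorem IsNormal.sub {φ ψ : StrongDual ℝ (Lip0 o)} (hφ : IsNormal φ) (hψ : IsNormal ψ) :
    IsNormal (φ - ψ) := fun C => by
  have h := (hφ C).sub (hψ C)
  rwa [sub_zero] at h

theorem isNormal_of_mem_span {φ : StrongDual ℝ (Lip0 o)}
    (h : φ ∈ Submodule.span ℝ (range (delta o))) : IsNormal φ := by
  intro C
  induction h using Submodule.span_induction with
  | mem φ h =>
    obtain ⟨x, rfl⟩ := h
    exact tendsto_apply_boundedNhds C x
  | zero => exact tendsto_const_nhds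
  | add φ ψ _ _ h₁ h₂ =>
    have h := h₁.add h₂
    rwa [add_zero] at h
  | smul c φ _ h =>
    have h := h.const_mul c
    rwa [mul_zero] at h

/-- Norm approximation is uniform on bounded sets of functions, so normality survives norm limits of
combinations of evaluations. -/
theorem isNormal_of_mem_lipFree {φ : StrongDual ℝ (Lip0 o)} (h : φ ∈ lipFree o) :
    IsNormal φ := by
  intro C
  rw [Metric.tendsto_nhds]
  intro ε hε
  have hD : 0 < 2 * (|C| + 1) := by positivity
  obtain ⟨ψ, hψ, hd⟩ := Metric.mem_closure_iff.1 h (ε / (2 * (|C| + 1))) (by positivity)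
  filter_upwards [Metric.tendsto_nhds.1 (isNormal_of_mem_span hψ C) (ε / 2) (by positivity),
    eventually_boundedNhds o C] with f h1 h2
  have h3 := (φ - ψ).le_opNorm f
  rw [← dist_eq_norm] at h3
  have h4 : dist φ ψ * ‖f‖ ≤ ε / (2 * (|C| + 1)) * (|C| + 1) :=
    mul_le_mul hd.le (by linarith [le_abs_self C, h2.2]) (norm_nonneg _) (by positivity)
  have h5 : ε / (2 * (|C| + 1)) * (|C| + 1) = ε / 2 := by field_simp
  rw [Real.dist_eq, sub_zero] at h1 ⊢
  have h6 : φ f = (φ - ψ) f + ψ f := by simp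
  rw [h6]
  rw [Real.norm_eq_abs] at h3
  exact (abs_add_le _ _).trans_lt (by linarith)

/-- The positive part of a normal functional is normal. -/
theorem IsNormal.of_isLUB {m p : StrongDual ℝ (Lip0 o)} (hm : IsNormal m)
    (hp : ∀ f, 0 ≤ f → IsLUB (intervalValues m f) (p f)) : IsNormal p := by
  intro C
  have hp0 : 0 ≤ p := (isMinimumMajorant_of_isLUB hp).1.1
  have hC0 : 0 ≤ |C| • Lip0.rho o := Lip0.smul_nonneg (abs_nonneg C) Lip0.rho_nonneg
  refine Metric.tendsto_nhds.2 fun ε hε => ?_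
  -- The function `|C| ρ` dominates every `f` under consideration. Taking `g` nearly optimal for it
  -- yields `p f ≤ m (g ∧ f) + ε / 2`, and `m (g ∧ f)` tends to zero by normality of `m`.
  obtain ⟨_, ⟨g, hg, hgf, rfl⟩, hlt, -⟩ :=
    (hp _ hC0).exists_between (sub_lt_self (p (|C| • Lip0.rho o)) (half_pos hε))
  have hlim : Tendsto (fun f => m (g.inf f)) (boundedNhds o C) (𝓝 0) := by
    refine (hm (max ‖g‖ C)).comp (tendsto_inf.2 ⟨tendsto_comap_iff.2 (tendsto_pi_nhds.2 ?_),
      tendsto_principal.2 ?_⟩)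
    · intro x
      have := (tendsto_const_nhds (x := g x)).min (tendsto_apply_boundedNhds (o := o) C x)
      have h0 : min (g x) 0 = 0 := min_eq_right (hg x)
      rwa [h0] at this
    · filter_upwards [eventually_boundedNhds o C] with f hf
      exact ⟨fun x => le_min (hg x) (hf.1 x), (g.norm_inf_le f).trans (max_le_max_left _ hf.2)⟩
  filter_upwards [Metric.tendsto_nhds.1 hlim (ε / 2) (half_pos hε), eventually_boundedNhds o C]
    with f h1 hf
  have hfle : f ≤ |C| • Lip0.rho o := fun x => by
    have := (le_abs_self _).trans (f.abs_apply_le x)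
    exact this.trans (mul_le_mul_of_nonneg_right (hf.2.trans (le_abs_self C)) dist_nonneg)
  -- Here `g - g ∧ f = (g - f)⁺` lies in the order interval `[0, |C| ρ - f]`.
  have h2 : m (g - g.inf f) ≤ p (|C| • Lip0.rho o - f) := by
    refine (hp _ (Lip0.sub_nonneg.2 hfle)).1 ⟨_, fun x => by simp, fun x => ?_, rfl⟩
    have e1 := hgf x
    have e2 := hfle x
    simp only [Lip0.sub_apply, Lip0.inf_apply]
    rcases min_cases (g x) (f x) with h | h <;> rw [h.1] <;> linarith
  rw [map_sub, map_sub] at h2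
  rw [Real.dist_eq, sub_zero] at h1 ⊢
  rw [abs_of_nonneg (hp0 f hf.1)]
  linarith [le_abs_self (m (g.inf f))]

end

/-- A closed subspace is complete, so the integral can be formed inside it and carried over by the
inclusion. The measure may be infinite, so averaging arguments are avoided. -/
theorem integral_mem_of_isClosed {α E : Type*} [MeasurableSpace α] [NormedAddCommGroup E]
    [NormedSpace ℝ E] [CompleteSpace E] {V : Submodule ℝ E} (hV : IsClosed (V : Set E))
    {μ : Measure α} {f : α → E} (hf : Integrable f μ) (h : ∀ x, f x ∈ V) : ∫ x, f x ∂μ ∈ V := by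
  have : CompleteSpace V := hV.completeSpace_coe
  let g : α → V := fun x => ⟨f x, h x⟩
  have hg : Integrable g μ :=
    ⟨IsEmbedding.subtypeVal.aestronglyMeasurable_comp_iff.1 hf.1, hf.2⟩
  have e : ∫ x, f x ∂μ = ((∫ x, g x ∂μ : V) : E) := V.subtypeL.integral_comp_comm hg
  rw [e]
  exact Subtype.property _

/-! ### Measures concentrated on countable unions of compact sets -/

section

variable {M : Type*} [MetricSpace M] {o : M}

theorem continuous_delta : Continuous (delta o) := by
  refine (LipschitzWith.of_dist_le_mul (K := 1) fun x y => ?_).continuous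
  rw [dist_eq_norm, NNReal.coe_one, one_mul]
  refine ContinuousLinearMap.opNorm_le_bound _ dist_nonneg fun f => ?_
  have := f.abs_sub_le x y
  rw [mul_comm] at this
  exact this

theorem norm_delta_le (x : M) : ‖delta o x‖ ≤ dist x o :=
  LinearMap.mkContinuous_norm_le _ dist_nonneg _

theorem delta_mem (x : M) : delta o x ∈ lipFree o :=
  Submodule.le_topologicalClosure _ (Submodule.subset_span ⟨x, rfl⟩)

variable [MeasurableSpace M]

/-- `μ` is concentrated on a countable union of compact sets. -/
def SigmaCompactSupported (μ : Measure M) : Prop :=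
  ∃ K : ℕ → Set M, (∀ n, IsCompact (K n)) ∧ μ (⋃ n, K n)ᶜ = 0

theorem SigmaCompactSupported.mono {μ ν : Measure M} (h : SigmaCompactSupported ν) (hμ : μ ≪ ν) :
    SigmaCompactSupported μ :=
  let ⟨K, hK, h0⟩ := h
  ⟨K, hK, hμ h0⟩

variable [BorelSpace M]

/-- Finite Borel measures on metric spaces are inner regular for closed sets and outer regular;
cutting down to a large finite union of the compact sets turns closed into compact. -/
theorem SigmaCompactSupported.isRadon {μ : Measure M} [IsFiniteMeasure μ]
    (h : SigmaCompactSupported μ) : IsRadon μ := by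
  obtain ⟨K, hK, h0⟩ := h
  refine ⟨inferInstance, ⟨fun A hA r hr => ?_⟩, inferInstance⟩
  have h1 : μ A = ⨆ n, μ (A ∩ accumulate K n) := by
    rw [← Monotone.measure_iUnion
      (fun i j hij => inter_subset_inter_right A (monotone_accumulate hij)),
      ← inter_iUnion, iUnion_accumulate]
    exact (measure_inter_conull h0).symm
  rw [h1] at hr
  obtain ⟨n, hn⟩ := lt_iSup_iff.1 hr
  have hc := isCompact_accumulate hK n
  obtain ⟨F, hF, hFc, hrF⟩ := (hA.inter hc.measurableSet).exists_lt_isClosed_of_ne_top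
    (measure_ne_top _ _) hn
  exact ⟨F, hF.trans inter_subset_left, hc.of_isClosed_subset hFc (hF.trans inter_subset_right),
    hrF⟩

/-- A functional represented by a measure concentrated on a countable union of compact sets is
the Bochner integral of the evaluation functionals, hence lies in the Lipschitz-free space. -/
theorem mem_lipFree_of_isRepresentedBy {φ : StrongDual ℝ (Lip0 o)} {μ : Measure M}
    (h : IsRepresentedBy φ μ) (hμ : SigmaCompactSupported μ) : φ ∈ lipFree o := by
  obtain ⟨K, hK, h0⟩ := hμ
  -- `M` need not be separable; the σ-compact support supplies the separable essential range.
  have hDm : AEStronglyMeasurable (delta o) μ := by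
    borelize (StrongDual ℝ (Lip0 o))
    refine aestronglyMeasurable_iff_aemeasurable_separable.2
      ⟨continuous_delta.measurable.aemeasurable, ⋃ n, delta o '' K n,
        TopologicalSpace.IsSeparable.iUnion
          fun n => ((hK n).image continuous_delta).isSeparable, ?_⟩
    filter_upwards [compl_mem_ae_iff.2 h0] with x hx
    rw [← image_iUnion]
    exact mem_image_of_mem _ (by simpa using hx)
  have hDi : Integrable (delta o) μ :=
    Integrable.mono' (h (Lip0.rho o)).1 hDm (Eventually.of_forall norm_delta_le)
  have e : φ = ∫ x, delta o x ∂μ := by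
    ext f
    rw [(h f).2]
    exact (ContinuousLinearMap.integral_apply hDi f).symm
  rw [e]
  exact integral_mem_of_isClosed (Submodule.isClosed_topologicalClosure _) hDi delta_mem

/-- Integration against a measure for which the distance to the base point is integrable. -/
theorem exists_isRepresentedBy {μ : Measure M} (h : Integrable (fun x => dist x o) μ) :
    ∃ φ : StrongDual ℝ (Lip0 o), IsRepresentedBy φ μ := by
  have hi : ∀ f : Lip0 o, Integrable (fun x => f x) μ := fun f =>
    (h.const_mul ‖f‖).mono' f.continuous.measurable.aestronglyMeasurable
      (Eventually.of_forall fun x => f.abs_apply_le x)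
  let L : Lip0 o →ₗ[ℝ] ℝ :=
    { toFun := fun f => ∫ x, f x ∂μ
      map_add' := fun f g => integral_add (hi f) (hi g)
      map_smul' := fun c f => integral_const_mul c _ }
  refine ⟨L.mkContinuous (∫ x, dist x o ∂μ) fun f => ?_, fun f => ⟨hi f, rfl⟩⟩
  rw [mul_comm, ← integral_const_mul]
  exact norm_integral_le_of_norm_le (h.const_mul ‖f‖)
    (Eventually.of_forall fun x => f.abs_apply_le x)

/-- Measures representing the minimum majorant `p` of `m` and `p - m` are mutually singular. -/
theorem mutuallySingular_of_isMinimumMajorant {m p : StrongDual ℝ (Lip0 o)}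
    (hp : IsMinimumMajorant m p) {μ ν : Measure M} (hμo : μ {o} = 0)
    (hμ : IsRepresentedBy p μ) (hν : IsRepresentedBy (p - m) ν) : μ ⟂ₘ ν := by
  rw [Measure.mutuallySingular_iff_disjoint]
  intro τ hτμ hτν
  have hτi : Integrable (fun x => dist x o) τ := (hμ (Lip0.rho o)).1.mono_measure hτμ
  obtain ⟨ψ, hψ⟩ := exists_isRepresentedBy hτi
  -- `τ ≤ μ` keeps `p - ψ` positive, and `τ ≤ ν` keeps it above `m`. Minimality of `p` then forces
  -- `∫ ρ dτ ≤ 0`, so `τ` can only charge `o`.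
  have hmaj : IsMajorant m (p - ψ) := by
    constructor
    · intro f hf
      have h1 := integral_mono_measure hτμ (Eventually.of_forall hf) (hμ f).1
      rw [← (hμ f).2, ← (hψ f).2] at h1
      simpa using h1
    · intro f hf
      have h1 := integral_mono_measure hτν (Eventually.of_forall hf) (hν f).1
      rw [← (hν f).2, ← (hψ f).2] at h1
      simp only [sub_apply] at h1 ⊢
      linarith
  have h1 := (hp.2 _ hmaj).2 (Lip0.rho o) Lip0.rho_nonneg
  have h2 := (hψ (Lip0.rho o)).2
  simp only [sub_apply] at h1
  have h3 : ∫ x, dist x o ∂τ = 0 :=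
    le_antisymm (h2 ▸ by linarith) (integral_nonneg fun x => dist_nonneg)
  rw [integral_eq_zero_iff_of_nonneg (fun x => dist_nonneg) hτi] at h3
  have h4 : τ {o}ᶜ = 0 := by
    refine measure_mono_null (fun x hx => ?_) h3
    simpa using hx
  have h5 : τ {o} = 0 := le_antisymm ((hτμ _).trans hμo.le) bot_le
  have h6 : τ = 0 := by
    rw [← Measure.measure_univ_eq_zero, ← union_compl_self {o}]
    exact measure_union_null h5 h4
  rw [h6]
  exact bot_le

end

/-! ### Positive functionals on function spaces over compactifications -/

section

/-- A positive functional on a space of continuous functions containing the constants on a compact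
Hausdorff space is given by a finite measure. -/
theorem exists_measure_of_positive {X : Type*} [TopologicalSpace X] [CompactSpace X] [T2Space X]
    [MeasurableSpace X] [BorelSpace X] (S : Submodule ℝ C(X, ℝ)) (h1 : (1 : C(X, ℝ)) ∈ S)
    (L : S →ₗ[ℝ] ℝ) (hL : ∀ f : S, (0 : C(X, ℝ)) ≤ f → 0 ≤ L f) :
    ∃ ν : Measure X, IsFiniteMeasure ν ∧ ∀ f : S, ∫ x, (f : C(X, ℝ)) x ∂ν = L f := by
  -- The constants make `S` cofinal: adding `‖y‖` makes any `y` nonnegative.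
  obtain ⟨g, hg, hg0⟩ := riesz_extension (PointedCone.positive ℝ C(X, ℝ)) ⟨S, L⟩
    (fun x hx => hL x hx) (fun y => ⟨⟨‖y‖ • 1, S.smul_mem _ h1⟩, fun x => by
      have := neg_abs_le (y x)
      have h2 := y.norm_coe_le_norm x
      rw [Real.norm_eq_abs] at h2
      change 0 ≤ ‖y‖ * 1 + y x
      linarith⟩)
  let G : CompactlySupportedContinuousMap X ℝ →ₗ[ℝ] ℝ :=
    { toFun := fun f => g f.toContinuousMap
      map_add' := fun a b => map_add g a.toContinuousMap b.toContinuousMap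
      map_smul' := fun c a => map_smul g c a.toContinuousMap }
  let P := PositiveLinearMap.mk₀ G fun f hf => hg0 _ hf
  refine ⟨RealRMK.rieszMeasure P, inferInstance, fun f => ?_⟩
  have := RealRMK.integral_rieszMeasure P (CompactlySupportedContinuousMap.continuousMapEquiv f)
  exact this.trans (hg f)

/-- The range is not assumed Borel. Images of Borel sets are traces of Borel sets on the range,
hence null-measurable because its complement is null. -/
theorem map_comap_of_isEmbedding {M X : Type*} [TopologicalSpace M] [MeasurableSpace M]
    [BorelSpace M] [TopologicalSpace X] [MeasurableSpace X] [BorelSpace X] {i : M → X}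
    (hi : IsEmbedding i) {ν : Measure X} (hν : ν (range i)ᶜ = 0) :
    (ν.comap i).map i = ν := by
  have hr : NullMeasurableSet (range i) ν := by
    have : NullMeasurableSet (range i)ᶜ ν := NullMeasurableSet.of_null hν
    simpa using this.compl
  have himg : ∀ s, MeasurableSet s → NullMeasurableSet (i '' s) ν := by
    intro s hs
    have e : MeasurableSpace.comap i (borel X) = borel M := by
      rw [hi.eq_induced, borel_comap]
    rw [BorelSpace.measurable_eq (α := M), ← e] at hs
    obtain ⟨t, ht, rfl⟩ := hs
    rw [image_preimage_eq_inter_range]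
    rw [← BorelSpace.measurable_eq (α := X)] at ht
    exact ht.nullMeasurableSet.inter hr
  ext s hs
  rw [Measure.map_apply hi.continuous.measurable hs,
    Measure.comap_apply₀ i ν hi.injective himg
      (hi.continuous.measurable hs).nullMeasurableSet, image_preimage_eq_inter_range]
  exact measure_inter_conull hν

theorem exists_stoneCech_extension {M : Type*} [TopologicalSpace M] {h : M → ℝ}
    (hc : Continuous h) {B : ℝ} (hB : ∀ x, |h x| ≤ B) :
    ∃ H : C(StoneCech M, ℝ), ∀ x, H (stoneCechUnit x) = h x := by
  let h' : M → Icc (-B) B := fun x => ⟨h x, abs_le.1 (hB x)⟩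
  have hc' : Continuous h' := hc.subtype_mk _
  exact ⟨⟨fun y => (stoneCechExtend hc' y : Icc (-B) B),
    continuous_subtype_val.comp (continuous_stoneCechExtend hc')⟩, fun x => by
      simp [stoneCechExtend_stoneCechUnit, h']⟩

/-- A point of a compactification of a complete metric space, at which the extensions of the
functions `min 1 (infDist · (F n))` with `F n` finite are at most `2⁻ⁿ` eventually, belongs to the
space. -/
theorem mem_range_of_totallyBounded {M X : Type*} [MetricSpace M] [CompleteSpace M]
    [TopologicalSpace X] [T2Space X] {i : M → X} (hi : IsDenseInducing i) (F : ℕ → Set M)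
    (hF : ∀ n, (F n).Finite) (hne : ∀ n, (F n).Nonempty) (H : ℕ → C(X, ℝ))
    (hH : ∀ n x, H n (i x) = min 1 (Metric.infDist x (F n))) (N : ℕ) {y : X}
    (hy : ∀ n, N ≤ n → H n y ≤ (1 / 2) ^ n) : y ∈ range i := by
  have := hi.comap_nhds_neBot y
  let u := Ultrafilter.of (comap i (𝓝 y))
  have hu : Tendsto i u (𝓝 y) := tendsto_comap.mono_left (Ultrafilter.of_le _)
  have hC : Cauchy (u : Filter M) := by
    refine Metric.cauchy_iff.2 ⟨inferInstance, fun ε hε => ?_⟩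
    -- Replacing `ε` by `min 1 ε` keeps the radius below the truncation level 1, so a small `H n`
    -- really bounds the distance to `F n`. An ultrafilter containing finitely many balls' union
    -- contains one of them, hence is Cauchy.
    obtain ⟨n0, hn0⟩ := exists_pow_lt_of_lt_one (show 0 < min 1 ε / 4 by positivity)
      (show (1 / 2 : ℝ) < 1 by norm_num)
    set n := max N n0
    have hn : (1 / 2 : ℝ) ^ n < min 1 ε / 4 :=
      (pow_le_pow_of_le_one (by norm_num) (by norm_num) (le_max_right _ _)).trans_lt hn0
    have h1 : ∀ᶠ x in (u : Filter M), H n (i x) < min 1 ε / 2 :=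
      (((H n).continuous.tendsto y).comp hu).eventually_lt_const
        ((hy n (le_max_left _ _)).trans_lt (hn.trans (by
          have : 0 < min 1 ε := by positivity
          linarith)))
    have h2 : ⋃ a ∈ F n, Metric.ball a (min 1 ε / 2) ∈ u := by
      filter_upwards [h1] with x hx
      rw [hH] at hx
      have hx' : Metric.infDist x (F n) < min 1 ε / 2 := by
        rcases min_lt_iff.1 hx with h | h
        · have := min_le_left 1 ε
          linarith
        · exact h
      obtain ⟨a, ha, hxa⟩ := (Metric.infDist_lt_iff (hne n)).1 hx'
      exact mem_biUnion ha hxa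
    obtain ⟨a, -, ha⟩ := (Ultrafilter.finite_biUnion_mem_iff (hF n)).1 h2
    refine ⟨_, ha, fun x hx z hz => ?_⟩
    have := dist_triangle_right x z a
    rw [Metric.mem_ball] at hx hz
    have := min_le_right 1 ε
    linarith
  obtain ⟨z, hz⟩ := CompleteSpace.complete hC
  have hz' : Tendsto i u (𝓝 (i z)) := (hi.continuous.tendsto z).mono_left hz
  exact ⟨z, tendsto_nhds_unique hz' hu⟩

end

/-! ### Integral representation of positive normal functionals -/

section

variable {M : Type*} [MetricSpace M] {o : M}

theorem lipschitzWith_mul_of_bounded {f g : M → ℝ} {K L B C : ℝ≥0} (hf : LipschitzWith K f)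
    (hg : LipschitzWith L g) (hB : ∀ x, |f x| ≤ B) (hC : ∀ x, |g x| ≤ C) :
    LipschitzWith (B * L + C * K) fun x => f x * g x := by
  refine LipschitzWith.of_dist_le_mul fun x y => ?_
  have h1 := hf.dist_le_mul x y
  have h2 := hg.dist_le_mul x y
  rw [Real.dist_eq] at h1 h2 ⊢
  have e : f x * g x - f y * g y = f x * (g x - g y) + g y * (f x - f y) := by ring
  rw [e]
  refine (abs_add_le _ _).trans ?_
  rw [abs_mul, abs_mul]
  have h3 := mul_le_mul (hB x) h2 (abs_nonneg _) B.2
  have h4 := mul_le_mul (hC y) h1 (abs_nonneg _) C.2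
  push_cast
  nlinarith

/-- The truncated distance to the base point. -/
def weight (o x : M) : ℝ := min (dist x o) 1

theorem weight_nonneg (x : M) : 0 ≤ weight o x := le_min dist_nonneg zero_le_one

theorem abs_weight_le (x : M) : |weight o x| ≤ (1 : ℝ≥0) := by
  rw [abs_of_nonneg (weight_nonneg x)]
  exact min_le_right _ _

@[simp] theorem weight_self : weight o o = 0 := by simp [weight]

theorem lipschitzWith_weight : LipschitzWith 1 (weight o) :=
  (LipschitzWith.dist_left o).min_const 1

theorem lipschitzWith_mul_weight {h : M → ℝ} {K B : ℝ≥0} (hh : LipschitzWith K h)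
    (hB : ∀ x, |h x| ≤ B) : LipschitzWith (B * 1 + 1 * K) fun x => h x * weight o x :=
  lipschitzWith_mul_of_bounded hh lipschitzWith_weight hB abs_weight_le

/-- The continuous functions on the Stone–Čech compactification with Lipschitz restriction. -/
def lipschitzRestrict (M : Type*) [MetricSpace M] : Submodule ℝ C(StoneCech M, ℝ) where
  carrier := {H | ∃ K : ℝ≥0, LipschitzWith K fun x : M => H (stoneCechUnit x)}
  zero_mem' := ⟨0, LipschitzWith.const 0⟩
  add_mem' := by
    rintro a b ⟨K, hK⟩ ⟨L, hL⟩
    exact ⟨K + L, hK.add hL⟩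
  smul_mem' := by
    rintro c a ⟨K, hK⟩
    exact ⟨‖c‖₊ * K, (lipschitzWith_smul c).comp hK⟩

/-- Restriction to `M` followed by multiplication with the weight. -/
def weightedRestrict (o : M) : lipschitzRestrict M →ₗ[ℝ] Lip0 o where
  toFun H := ⟨fun x => (H : C(StoneCech M, ℝ)) (stoneCechUnit x) * weight o x, by
    obtain ⟨H, K, hK⟩ := H
    exact (Lip0.ofLipschitz (o := o) _ (by simp) (lipschitzWith_mul_weight (B := ‖H‖₊) hK
      fun x => H.norm_coe_le_norm _)).2⟩
  map_add' a b := DFunLike.ext _ _ fun x => add_mul _ _ _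
  map_smul' c a := DFunLike.ext _ _ fun x => mul_assoc _ _ _

theorem weightedRestrict_apply (H : lipschitzRestrict M) (x : M) :
    weightedRestrict o H x = (H : C(StoneCech M, ℝ)) (stoneCechUnit x) * weight o x := rfl

/-- For a normal functional there are finite sets such that the functional is small on the
truncated distances to them. -/
theorem IsNormal.exists_finite {φ : StrongDual ℝ (Lip0 o)} (hn : IsNormal φ) {ε : ℝ}
    (hε : 0 < ε) : ∃ F : Set M, F.Finite ∧ F.Nonempty ∧ ∀ g : Lip0 o,
      (∀ x, g x = min 1 (Metric.infDist x F) * weight o x) → φ g ≤ ε := by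
  classical
  -- The net runs over all finite sets because no sequence need suffice when `M` is nonseparable.
  -- Including `o` keeps the sets nonempty.
  let F : Finset M → Set M := fun s => insert o (s : Set M)
  have hB : ∀ s x, |min 1 (Metric.infDist x (F s))| ≤ (1 : ℝ≥0) := fun s x => by
    rw [abs_of_nonneg (le_min zero_le_one Metric.infDist_nonneg)]
    exact min_le_left _ _
  have hl : ∀ s, LipschitzWith 1 fun x => min 1 (Metric.infDist x (F s)) := fun s =>
    (Metric.lipschitz_infDist_pt (F s)).const_min 1
  let u : Finset M → Lip0 o := fun s => Lip0.ofLipschitz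
    (fun x => min 1 (Metric.infDist x (F s)) * weight o x) (by simp)
    (lipschitzWith_mul_weight (hl s) (hB s))
  have ht : Tendsto (fun s => φ (u s)) atTop (𝓝 0) := by
    refine hn.tendsto (C := 2) (fun s x => ?_) (fun s => ?_) fun x => ?_
    · exact mul_nonneg (le_min zero_le_one Metric.infDist_nonneg) (weight_nonneg x)
    · refine (Lip0.norm_ofLipschitz_le _ _ _).trans ?_
      norm_num
    · refine tendsto_const_nhds.congr' ?_
      filter_upwards [eventually_ge_atTop {x}] with s hs
      have hx : x ∈ F s := mem_insert_of_mem _ (hs (Finset.mem_singleton_self x))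
      simp [u, Metric.infDist_zero_of_mem hx]
  obtain ⟨s, hs⟩ := (ht.eventually (gt_mem_nhds hε)).exists
  refine ⟨F s, s.finite_toSet.insert o, ⟨o, mem_insert _ _⟩, fun g hg => ?_⟩
  have : g = u s := DFunLike.ext _ _ hg
  rw [this]
  exact hs.le

/-- The truncations `min (f - 1 / (n + 1))⁺ n` of a function. -/
def Lip0.trunc (f : Lip0 o) (n : ℕ) : Lip0 o :=
  Lip0.ofLipschitz (fun x => min (max (f x - 1 / (n + 1)) 0) n)
    (by
      have h1 : (0 : ℝ) ≤ 1 / (n + 1) := by positivity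
      have h2 : (0 : ℝ) ≤ n := by positivity
      simp only [Lip0.apply_base, zero_sub]
      rw [max_eq_right (by linarith), min_eq_left h2])
    (K := ‖f‖₊)
    ((LipschitzWith.max_const (by
      refine LipschitzWith.of_dist_le_mul fun x y => ?_
      rw [dist_sub_right]
      exact f.lipschitzWith.dist_le_mul x y) 0).min_const n)

theorem Lip0.trunc_apply (f : Lip0 o) (n : ℕ) (x : M) :
    f.trunc n x = min (max (f x - 1 / (n + 1)) 0) n := rfl

theorem Lip0.norm_trunc_le (f : Lip0 o) (n : ℕ) : ‖f.trunc n‖ ≤ ‖f‖ :=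
  Lip0.norm_ofLipschitz_le _ _ _

theorem Lip0.trunc_nonneg (f : Lip0 o) (n : ℕ) : 0 ≤ f.trunc n :=
  fun _ => le_min (le_max_right _ _) (Nat.cast_nonneg n)

theorem Lip0.trunc_le {f : Lip0 o} (hf : 0 ≤ f) (n : ℕ) : f.trunc n ≤ f := fun x => by
  have h1 : (0 : ℝ) ≤ 1 / (n + 1) := by positivity
  exact (min_le_left _ _).trans (max_le (by linarith) (hf x))

theorem Lip0.trunc_mono (f : Lip0 o) (x : M) : Monotone fun n => f.trunc n x := fun a b hab => by
  have h1 : (a : ℝ) ≤ b := by exact_mod_cast hab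
  have h2 : (1 : ℝ) / (b + 1) ≤ 1 / (a + 1) := Nat.one_div_le_one_div hab
  exact min_le_min (max_le_max_right _ (by linarith)) h1

theorem Lip0.tendsto_trunc {f : Lip0 o} (hf : 0 ≤ f) (x : M) :
    Tendsto (fun n => f.trunc n x) atTop (𝓝 (f x)) := by
  have h1 : Tendsto (fun n : ℕ => max (f x - 1 / ((n : ℝ) + 1)) 0) atTop (𝓝 (f x)) := by
    have := ((tendsto_const_nhds (x := f x)).sub
      (tendsto_one_div_add_atTop_nhds_zero_nat (𝕜 := ℝ))).max (tendsto_const_nhds (x := (0 : ℝ)))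
    have h0 : max (f x) 0 = f x := max_eq_left (hf x)
    rwa [sub_zero, h0] at this
  refine h1.congr' ?_
  obtain ⟨N, hN⟩ := exists_nat_ge (f x)
  filter_upwards [eventually_ge_atTop N] with n hn
  have h2 : (N : ℝ) ≤ n := by exact_mod_cast hn
  have h3 : (0 : ℝ) ≤ 1 / (n + 1) := by positivity
  rw [Lip0.trunc_apply, min_eq_left]
  exact max_le (by linarith) (by positivity)

/-- Truncations are the product of a bounded Lipschitz function and the weight. -/
theorem Lip0.exists_trunc_div_weight (f : Lip0 o) (n : ℕ) :
    ∃ K B : ℝ≥0, LipschitzWith K (fun x => (weight o x)⁻¹ * f.trunc n x) ∧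
      (∀ x, |(weight o x)⁻¹ * f.trunc n x| ≤ B) ∧
      ∀ x, f.trunc n x = ((weight o x)⁻¹ * f.trunc n x) * weight o x := by
  have hn : (0 : ℝ) < n + 1 := by positivity
  have hf : 0 < ‖f‖ + 1 := by positivity
  -- Where the truncation is nonzero, `1 / (n + 1) ≤ f x ≤ (‖f‖ + 1) d(x, o)`, so the weight is at
  -- least `c`. It may therefore be replaced by `max w c`, whose inverse is Lipschitz.
  set c : ℝ≥0 := ⟨min (1 / ((n + 1) * (‖f‖ + 1))) 1, by positivity⟩
  have hc0 : (0 : ℝ) < c := by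
    change (0 : ℝ) < min (1 / ((n + 1) * (‖f‖ + 1))) 1
    positivity
  have hlow : ∀ x, f.trunc n x ≠ 0 → (c : ℝ) ≤ weight o x := by
    intro x hx
    refine min_le_min_right _ ?_
    have h1 : 1 / ((n : ℝ) + 1) ≤ f x := by
      by_contra! h
      refine hx ?_
      rw [Lip0.trunc_apply, max_eq_right (by linarith), min_eq_left (by positivity)]
    have h2 := (le_abs_self _).trans (f.abs_apply_le x)
    have h3 : ‖f‖ * dist x o ≤ (‖f‖ + 1) * dist x o :=
      mul_le_mul_of_nonneg_right (by linarith) dist_nonneg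
    rw [← div_div, div_le_iff₀ hf]
    linarith
  have hinv : ∀ x, (weight o x)⁻¹ * f.trunc n x = (max (weight o x) c)⁻¹ * f.trunc n x := by
    intro x
    by_cases hx : f.trunc n x = 0
    · simp [hx]
    · rw [max_eq_left (hlow x hx)]
  have hpos : ∀ x, (0 : ℝ) < max (weight o x) c := fun x => hc0.trans_le (le_max_right _ _)
  have hL : LipschitzWith (c⁻¹ * c⁻¹) fun x => (max (weight o x) c)⁻¹ := by
    refine LipschitzWith.of_dist_le_mul fun x y => ?_
    have h1 := ((lipschitzWith_weight (o := o)).max_const (c : ℝ)).dist_le_mul x y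
    rw [NNReal.coe_one, one_mul] at h1
    rw [dist_inv_inv₀ (hpos x).ne' (hpos y).ne', Real.norm_of_nonneg (hpos x).le,
      Real.norm_of_nonneg (hpos y).le]
    push_cast
    rw [← mul_inv, inv_mul_eq_div]
    exact div_le_div₀ dist_nonneg h1 (mul_pos hc0 hc0)
      (mul_le_mul (le_max_right _ _) (le_max_right _ _) hc0.le (hpos x).le)
  have hB1 : ∀ x, |(max (weight o x) c)⁻¹| ≤ (c⁻¹ : ℝ≥0) := fun x => by
    rw [abs_of_nonneg (inv_nonneg.2 (hpos x).le)]
    push_cast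
    exact inv_anti₀ hc0 (le_max_right _ _)
  have hB2 : ∀ x, |f.trunc n x| ≤ (n : ℝ≥0) := fun x => by
    rw [abs_of_nonneg (f.trunc_nonneg n x)]
    exact min_le_right _ _
  refine ⟨c⁻¹ * ‖f.trunc n‖₊ + n * (c⁻¹ * c⁻¹), c⁻¹ * n, ?_, fun x => ?_, fun x => ?_⟩
  · simp_rw [hinv]
    exact lipschitzWith_mul_of_bounded hL (f.trunc n).lipschitzWith hB1 hB2
  · rw [hinv, abs_mul, NNReal.coe_mul]
    exact mul_le_mul (hB1 x) (hB2 x) (abs_nonneg _) (NNReal.coe_nonneg _)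
  · by_cases hx : f.trunc n x = 0
    · simp [hx]
    · have := (hc0.trans_le (hlow x hx)).ne'
      field_simp

/-- The remainders are positive, bounded in norm by `2 ‖f‖` and pointwise null, so normality plays
the role of dominated convergence. -/
theorem IsNormal.tendsto_trunc {φ : StrongDual ℝ (Lip0 o)} (hn : IsNormal φ) {f : Lip0 o}
    (hf : 0 ≤ f) : Tendsto (fun n => φ (f.trunc n)) atTop (𝓝 (φ f)) := by
  have h : Tendsto (fun n => φ (f - f.trunc n)) atTop (𝓝 0) := by
    refine hn.tendsto (C := ‖f‖ + ‖f‖) (fun n => Lip0.sub_nonneg.2 (Lip0.trunc_le hf n))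
      (fun n => (norm_sub_le _ _).trans (by linarith [f.norm_trunc_le n])) fun x => ?_
    have := (tendsto_const_nhds (x := f x)).sub (Lip0.tendsto_trunc hf x)
    rwa [sub_self] at this
  have h2 := (tendsto_const_nhds (x := φ f)).sub h
  simpa using h2

/-! ### Construction of the representing measure -/

variable [CompleteSpace M] [MeasurableSpace M] [BorelSpace M]

/-- A positive normal functional is given on weighted bounded Lipschitz functions by a finite
tight measure. -/
theorem IsNormal.exists_weighted_measure {φ : StrongDual ℝ (Lip0 o)} (hn : IsNormal φ)
    (h0 : 0 ≤ φ) : ∃ ν : Measure M, IsFiniteMeasure ν ∧ SigmaCompactSupported ν ∧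
      ∀ (g : Lip0 o) (h : M → ℝ) (K B : ℝ≥0), LipschitzWith K h → (∀ x, |h x| ≤ B) →
        (∀ x, g x = h x * weight o x) → φ g = ∫ x, h x ∂ν := by
  borelize (StoneCech M)
  have hemb : IsEmbedding (stoneCechUnit : M → StoneCech M) := isEmbedding_stoneCechUnit
  obtain ⟨ν, hfin, hν⟩ := exists_measure_of_positive (lipschitzRestrict M)
    ⟨0, LipschitzWith.const 1⟩ (φ.toLinearMap ∘ₗ weightedRestrict o) fun H hH =>
      h0 _ fun x => mul_nonneg (hH _) (weight_nonneg x)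
  have hrep : ∀ (g : Lip0 o) (h : M → ℝ) (K : ℝ≥0) (H : C(StoneCech M, ℝ)), LipschitzWith K h →
      (∀ x, H (stoneCechUnit x) = h x) → (∀ x, g x = h x * weight o x) →
      φ g = ∫ y, H y ∂ν := by
    intro g h K H hK hH hg
    have hHK : H ∈ lipschitzRestrict M := ⟨K, by simpa only [hH] using hK⟩
    rw [hν ⟨H, hHK⟩]
    have : g = weightedRestrict o ⟨H, hHK⟩ := DFunLike.ext _ _ fun x => by
      rw [hg, weightedRestrict_apply, hH]
    rw [this]
    rfl
  -- With `4⁻ⁿ`, Markov's inequality at level `2⁻ⁿ` leaves the summable bound `2⁻ⁿ` needed for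
  -- Borel–Cantelli.
  choose F hF hne hFε using fun n : ℕ => hn.exists_finite (ε := (1 / 4) ^ n) (by positivity)
  have hB : ∀ n x, |min 1 (Metric.infDist x (F n))| ≤ (1 : ℝ≥0) := fun n x => by
    rw [abs_of_nonneg (le_min zero_le_one Metric.infDist_nonneg)]
    exact min_le_left _ _
  have hl : ∀ n, LipschitzWith 1 fun x => min 1 (Metric.infDist x (F n)) := fun n =>
    (Metric.lipschitz_infDist_pt (F n)).const_min 1
  choose H hH using fun n => exists_stoneCech_extension (hl n).continuous (hB n)
  have hint : ∀ n, ∫ y, H n y ∂ν ≤ (1 / 4) ^ n := fun n => by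
    let g : Lip0 o := Lip0.ofLipschitz (fun x => min 1 (Metric.infDist x (F n)) * weight o x)
      (by simp) (lipschitzWith_mul_weight (hl n) (hB n))
    rw [← hrep g _ 1 (H n) (hl n) (hH n) fun x => rfl]
    exact hFε n g fun x => rfl
  have hpos : ∀ n y, 0 ≤ H n y := fun n y => by
    have hc : IsClosed {y | 0 ≤ H n y} := isClosed_le continuous_const (H n).continuous
    refine denseRange_stoneCechUnit.induction_on y hc fun x => ?_
    rw [hH]
    exact le_min zero_le_one Metric.infDist_nonneg
  have hmeas : ∀ n, ν {y | (1 / 2) ^ n ≤ H n y} ≤ ENNReal.ofReal ((1 / 2) ^ n) := fun n => by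
    have hi : Integrable (H n) ν := by
      refine Integrable.of_bound (H n).continuous.measurable.aestronglyMeasurable ‖H n‖
        (Eventually.of_forall fun y => (H n).norm_coe_le_norm y)
    have h1 := (mul_meas_ge_le_integral_of_nonneg (Eventually.of_forall (hpos n)) hi
      ((1 / 2) ^ n)).trans (hint n)
    have h2 : (1 / 4 : ℝ) ^ n = (1 / 2) ^ n * (1 / 2) ^ n := by rw [← mul_pow]; norm_num
    rw [h2] at h1
    exact (ENNReal.le_ofReal_iff_toReal_le (measure_ne_top _ _) (by positivity)).2
      (le_of_mul_le_mul_left h1 (by positivity))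
  have hae : ∀ᵐ y ∂ν, ∀ᶠ n in atTop, y ∉ {y | (1 / 2) ^ n ≤ H n y} := by
    refine ae_eventually_notMem (ne_top_of_le_ne_top ?_ (ENNReal.tsum_le_tsum hmeas))
    exact (summable_geometric_of_lt_one (by norm_num) (by norm_num)).tsum_ofReal_ne_top
  -- Closed in the compactification, hence compact, and contained in `M` by completeness; by
  -- Borel–Cantelli their union is conull.
  let Q : ℕ → Set (StoneCech M) := fun N => ⋂ n, ⋂ (_ : N ≤ n), {y | H n y ≤ (1 / 2) ^ n}
  have hQc : ∀ N, IsCompact (Q N) := fun N =>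
    (isClosed_iInter fun n => isClosed_iInter fun _ =>
      isClosed_le (H n).continuous continuous_const).isCompact
  have hQr : ∀ N, Q N ⊆ range (stoneCechUnit : M → StoneCech M) := fun N y hy =>
    mem_range_of_totallyBounded isDenseInducing_stoneCechUnit F hF hne H hH N fun n hn => by
      simp only [Q, mem_iInter] at hy
      exact hy n hn
  have hQν : ν (⋃ N, Q N)ᶜ = 0 := by
    rw [← mem_ae_iff]
    filter_upwards [hae] with y hy
    obtain ⟨N, hN⟩ := eventually_atTop.1 hy
    refine mem_iUnion.2 ⟨N, ?_⟩
    simp only [Q, mem_iInter]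
    exact fun n hn => (not_le.1 (hN n hn)).le
  have hr : ν (range (stoneCechUnit : M → StoneCech M))ᶜ = 0 :=
    measure_mono_null (compl_subset_compl.2 (iUnion_subset hQr)) hQν
  have hmap := map_comap_of_isEmbedding hemb hr
  have hum : Measurable (stoneCechUnit : M → StoneCech M) := continuous_stoneCechUnit.measurable
  refine ⟨ν.comap stoneCechUnit, ⟨?_⟩, ⟨fun N => stoneCechUnit ⁻¹' Q N, fun N => ?_, ?_⟩, ?_⟩
  · rw [← preimage_univ (f := (stoneCechUnit : M → StoneCech M)),
      ← Measure.map_apply hum MeasurableSet.univ, hmap]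
    exact measure_lt_top _ _
  · exact (hemb.isInducing.isCompact_preimage_iff (hQr N)).2 (hQc N)
  · rw [← preimage_iUnion, ← preimage_compl, ← Measure.map_apply hum
      (MeasurableSet.iUnion fun N => (hQc N).measurableSet).compl, hmap]
    exact hQν
  · intro g h K B hK hB hg
    obtain ⟨G, hG⟩ := exists_stoneCech_extension hK.continuous hB
    rw [hrep g h K G hK hG hg]
    simp_rw [← hG]
    rw [← integral_map hum.aemeasurable G.continuous.measurable.aestronglyMeasurable, hmap]

/-- A positive normal functional is represented by an almost Radon measure. -/
theorem IsNormal.exists_isAlmostRadon {φ : StrongDual ℝ (Lip0 o)} (hn : IsNormal φ)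
    (h0 : 0 ≤ φ) : ∃ μ : Measure M, IsAlmostRadon o μ ∧ IsRepresentedBy φ μ ∧
      SigmaCompactSupported μ := by
  obtain ⟨ν, hfin, hsc, hν⟩ := hn.exists_weighted_measure h0
  -- The convention `0⁻¹ = 0` gives `d o = 0`, so the new measure has no mass at `o`. Nothing is
  -- lost, since the truncations vanish there.
  let d : M → ℝ≥0∞ := fun x => ENNReal.ofReal (weight o x)⁻¹
  have hd : Measurable d := lipschitzWith_weight.continuous.measurable.inv.ennreal_ofReal
  have hsc' : SigmaCompactSupported (ν.withDensity d) :=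
    hsc.mono (withDensity_absolutelyContinuous _ _)
  refine ⟨ν.withDensity d, ⟨?_, fun K hK hoK => ?_⟩, ?_, hsc'⟩
  · rw [withDensity_apply _ (measurableSet_singleton o), Measure.restrict_singleton,
      lintegral_smul_measure, lintegral_dirac' _ hd]
    simp [d]
  · obtain ⟨r, hr, hrK⟩ := Metric.isOpen_iff.1 hK.isOpen_compl o hoK
    have hle : ∀ x ∈ K, d x ≤ ENNReal.ofReal (min r 1)⁻¹ := fun x hx => by
      refine ENNReal.ofReal_le_ofReal (inv_anti₀ (by positivity) (min_le_min_right _ ?_))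
      by_contra! h
      exact hrK h hx
    have : IsFiniteMeasure ((ν.withDensity d).restrict K) := by
      refine ⟨?_⟩
      rw [Measure.restrict_apply_univ, withDensity_apply _ hK.measurableSet]
      refine (setLIntegral_mono' hK.measurableSet hle).trans_lt ?_
      rw [setLIntegral_const]
      exact ENNReal.mul_lt_top ENNReal.ofReal_lt_top (measure_lt_top _ _)
    exact (hsc'.mono Measure.absolutelyContinuous_restrict).isRadon
  · have key : ∀ f : Lip0 o, 0 ≤ f →
        Integrable (fun x => f x) (ν.withDensity d) ∧ φ f = ∫ x, f x ∂(ν.withDensity d) := by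
      intro f hf
      have htr : ∀ n, ∫⁻ x, ENNReal.ofReal (f.trunc n x) ∂(ν.withDensity d)
          = ENNReal.ofReal (φ (f.trunc n)) := by
        intro n
        obtain ⟨K, B, hK, hB, hw⟩ := f.exists_trunc_div_weight n
        have hi : Integrable (fun x => (weight o x)⁻¹ * f.trunc n x) ν :=
          Integrable.of_bound hK.continuous.measurable.aestronglyMeasurable B
            (Eventually.of_forall hB)
        rw [hν _ _ K B hK hB hw, ofReal_integral_eq_lintegral_ofReal hi
          (Eventually.of_forall fun x =>
            mul_nonneg (inv_nonneg.2 (weight_nonneg x)) (f.trunc_nonneg n x)),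
          lintegral_withDensity_eq_lintegral_mul _ hd
            (f.trunc n).continuous.measurable.ennreal_ofReal]
        refine lintegral_congr fun x => ?_
        exact (ENNReal.ofReal_mul (inv_nonneg.2 (weight_nonneg x))).symm
      have h1 : Tendsto (fun n => ∫⁻ x, ENNReal.ofReal (f.trunc n x) ∂(ν.withDensity d)) atTop
          (𝓝 (∫⁻ x, ENNReal.ofReal (f x) ∂(ν.withDensity d))) := by
        refine lintegral_tendsto_of_tendsto_of_monotone
          (fun n => (f.trunc n).continuous.measurable.ennreal_ofReal.aemeasurable)
          (Eventually.of_forall fun x a b hab => ENNReal.ofReal_le_ofReal (f.trunc_mono x hab))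
          (Eventually.of_forall fun x => ENNReal.tendsto_ofReal (Lip0.tendsto_trunc hf x))
      simp_rw [htr] at h1
      -- Monotone convergence on the integral side meets normality on the functional side.
      have h2 := tendsto_nhds_unique h1 (ENNReal.tendsto_ofReal (hn.tendsto_trunc hf))
      have hfm : AEStronglyMeasurable (fun x => f x) (ν.withDensity d) :=
        f.continuous.measurable.aestronglyMeasurable
      have hf0 : 0 ≤ᵐ[ν.withDensity d] fun x => f x := Eventually.of_forall hf
      refine ⟨(lintegral_ofReal_ne_top_iff_integrable hfm hf0).1 (h2 ▸ ENNReal.ofReal_ne_top), ?_⟩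
      rw [integral_eq_lintegral_of_nonneg_ae hf0 hfm, h2, ENNReal.toReal_ofReal (h0 f hf)]
    intro f
    obtain ⟨g, h, hg, hh, rfl⟩ := f.exists_sub
    refine ⟨(key g hg).1.sub (key h hh).1, ?_⟩
    rw [map_sub, (key g hg).2, (key h hh).2]
    exact (integral_sub (key g hg).1 (key h hh).1).symm

end

end LipFree

end

theorem mainTheorem2 {M : Type*} [MetricSpace M] [CompleteSpace M] [MeasurableSpace M]
    [BorelSpace M] (o : M) (m : lipFree o) :
    (Majorizable m ↔ Majorizable (m : StrongDual ℝ (Lip0 o))) ∧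
    (Majorizable m →
      ∃ mp : lipFree o,
        IsMinimumMajorant m mp ∧
        IsMinimumMajorant (m : StrongDual ℝ (Lip0 o)) (mp : StrongDual ℝ (Lip0 o)) ∧
        ∃ μp μn : Measure M,
          IsAlmostRadon o μp ∧ IsAlmostRadon o μn ∧
          IsRepresentedBy (mp : StrongDual ℝ (Lip0 o)) μp ∧
          IsRepresentedBy ((mp - m : lipFree o) : StrongDual ℝ (Lip0 o)) μn ∧
          ∃ A B : Set M, MeasurableSet A ∧ MeasurableSet B ∧ Disjoint A B ∧
            μp Aᶜ = 0 ∧ μn Bᶜ = 0) := by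
  have hup : Majorizable m → Majorizable (m : StrongDual ℝ (Lip0 o)) :=
    fun ⟨y, hy⟩ => ⟨y, hy.1, hy.2⟩
  have main : Majorizable (m : StrongDual ℝ (Lip0 o)) → ∃ mp : lipFree o,
      IsMinimumMajorant (m : StrongDual ℝ (Lip0 o)) (mp : StrongDual ℝ (Lip0 o)) ∧
      ∃ μp μn : Measure M,
        IsAlmostRadon o μp ∧ IsAlmostRadon o μn ∧
        IsRepresentedBy (mp : StrongDual ℝ (Lip0 o)) μp ∧
        IsRepresentedBy ((mp - m : lipFree o) : StrongDual ℝ (Lip0 o)) μn := by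
    rintro ⟨φ, hφ⟩
    obtain ⟨p, hp⟩ := exists_isLUB_intervalValues hφ
    have hmin := isMinimumMajorant_of_isLUB hp
    have hm := isNormal_of_mem_lipFree m.2
    have hpn := hm.of_isLUB hp
    obtain ⟨μp, hμp, hpμ, hsc⟩ := hpn.exists_isAlmostRadon hmin.1.1
    -- `p - m` is itself positive and normal, so the same representation applies. Its σ-compact
    -- support is not needed: once `p` is in the Lipschitz-free space, so is `p - m`.
    obtain ⟨μn, hμn, hnμ, -⟩ := (hpn.sub hm).exists_isAlmostRadon
      (fun f hf => sub_nonneg.2 (hmin.1.2 f hf))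
    exact ⟨⟨p, mem_lipFree_of_isRepresentedBy hpμ hsc⟩, hmin, μp, μn, hμp, hμn, hpμ, hnμ⟩
  refine ⟨⟨hup, fun h => ?_⟩, fun h => ?_⟩
  · obtain ⟨mp, hmp, -⟩ := main h
    exact ⟨mp, hmp.1.1, hmp.1.2⟩
  · obtain ⟨mp, hmp, μp, μn, hμp, hμn, hpμ, hnμ⟩ := main (hup h)
    obtain ⟨s, hs, hs1, hs2⟩ := mutuallySingular_of_isMinimumMajorant hmp hμp.1 hpμ hnμ
    refine ⟨mp, ⟨⟨hmp.1.1, hmp.1.2⟩, fun z hz => ?_⟩, hmp, μp, μn, hμp, hμn, hpμ, hnμ, sᶜ, s,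
      hs.compl, hs, disjoint_compl_left, by rwa [compl_compl], hs2⟩
    have := hmp.2 z ⟨hz.1, hz.2⟩
    exact ⟨this.1, this.2⟩
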